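/- Let $\Gamma=(V,E)$ be a finite simplicial graph with an edge-labelling $\varphi:E\to\mathbb{N}_{\ge 2}$, and let $$W_\Gamma=\langle V\mid v^2,\ (vw)^{\varphi(\{v,w\})}\ \text{ for all } v\in V \text{ and } \{v,w\}\in E\rangle$$ be the associated Coxeter group. A vertex is called even if the labels of all edges containing it are even. For a group $G$, let $\mathrm{Spe}(G)\le\mathrm{Aut}(G)$ be the subgroup of special automorphisms, i.e. of those automorphisms $f$ such that $f(K)$ is conjugate to $K$ in $G$ for every subgroup $K\le G$ of order $2$. A group $G$ virtually surjects onto a group $Q$ if some finite-index subgroup of $G$ admits a surjective homomorphism onto $Q$. A countable group has Kazhdan's property (T) if every action of it by isometries on a real Hilbert space has a fixed point. Suppose that $\Gamma$ has two distinct non-adjacent even vertices $v$ and $w$. Then: 1. $\mathrm{Spe}(W_\Gamma)$ has finite index in $\mathrm{Aut}(W_\Gamma)$. 2. There is a surjective homomorphism $r:W_\Gamma\to\langle v\rangle*\langle w\rangle$ with $r(v)=v$, $r(w)=w$ and $r(x)=1$ for all $x\in V\setminus\{v,w\}$, and there is a homomorphism $\Psi:\mathrm{Spe}(W_\Gamma)\to\mathrm{Aut}(\langle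 v\rangle*\langle w\rangle)$ with $\Psi(f)\circ r=r\circ f$ for all $f\in\mathrm{Spe}(W_\Gamma)$, whose image is isomorphic to $\mathbb{Z}_2*\mathbb{Z}_2$. In particular, $\mathrm{Spe}(W_\Gamma)$ surjects onto $\mathbb{Z}_2*\mathbb{Z}_2$. 3. Hence $\mathrm{Aut}(W_\Gamma)$ virtually surjects onto $\mathbb{Z}_2*\mathbb{Z}_2$, that is, onto the infinite dihedral group. Moreover, $\mathrm{Aut}(W_\Gamma)$ is a countable group that does not have Kazhdan's property (T). -/

import Mathlib

universe u t

/-- A Coxeter graph on the vertex set `V`: a simplicial graph together with a labelling of its edges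
by integers `≥ 2`. (Finiteness of `V` is assumed where it is needed.) -/
structure CoxeterGraph (V : Type*) where
  /-- the underlying simplicial graph -/
  graph : SimpleGraph V
  /-- the edge labelling -/
  label : graph.edgeSet → ℕ
  two_le_label : ∀ e, 2 ≤ label e

namespace CoxeterGraph

variable {V : Type*} (Γ : CoxeterGraph V)

open Classical in
/-- The Coxeter matrix of a Coxeter graph: `1` on the diagonal, the label of the edge `{v, w}` if
`v` and `w` are adjacent, and `0` (Mathlib's encoding of `∞`, that is, no relation) otherwise. -/
noncomputable def toCoxeterMatrix : CoxeterMatrix V where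
  M := Matrix.of fun v w =>
    if h : Γ.graph.Adj v w then Γ.label ⟨s(v, w), h⟩ else if v = w then 1 else 0
  isSymm := by
    ext v w
    by_cases h : Γ.graph.Adj v w
    · have h' : Γ.graph.Adj w v := h.symm
      simp only [Matrix.transpose_apply, Matrix.of_apply, h, h', dif_pos]
      congr 2
      exact Sym2.eq_swap
    · have h' : ¬ Γ.graph.Adj w v := fun k => h k.symm
      simp [h, h', eq_comm]
  diagonal v := by simp
  off_diagonal v w hvw := by
    by_cases h : Γ.graph.Adj v w
    · have := Γ.two_le_label ⟨s(v, w), h⟩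
      simp only [Matrix.of_apply, h, dif_pos]
      omega
    · simp [h, hvw]

/-- The Coxeter group `W_Γ = ⟨V ∣ v², (vw)^{φ({v,w})} for v ∈ V and {v,w} ∈ E⟩`. -/
abbrev W : Type _ := Γ.toCoxeterMatrix.Group

/-- The generator of `W_Γ` given by the vertex `v`. -/
noncomputable def gen (v : V) : Γ.W := Γ.toCoxeterMatrix.simple v

/-- A vertex is even if the labels of all edges that contain it are even. -/
def IsEvenVertex (v : V) : Prop :=
  ∀ e : Γ.graph.edgeSet, v ∈ (e : Sym2 V) → Even (Γ.label e)

/-- The subgroup `⟨v⟩` of `W_Γ` generated by the vertex `v`. -/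
noncomputable abbrev genSubgroup (v : V) : Subgroup Γ.W := Subgroup.zpowers (Γ.gen v)

/-- The generator `v`, as an element of `⟨v⟩`. -/
noncomputable def genSelf (v : V) : Γ.genSubgroup v :=
  ⟨Γ.gen v, Subgroup.mem_zpowers (Γ.gen v)⟩

end CoxeterGraph

open scoped Pointwise in
/-- The group `Spe(G)` of special automorphisms of `G`: those automorphisms `f` that fix every
conjugacy class of subgroups of order `2`, that is, `f(K)` is conjugate to `K` whenever `|K| = 2`.
Here `f • K` is the image `f(K)`, and `MulAut.conj g • K` is `g K g⁻¹`. -/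
def specialAut (G : Type*) [Group G] : Subgroup (MulAut G) where
  carrier := {f | ∀ K : Subgroup G, Nat.card K = 2 → ∃ g : G, f • K = MulAut.conj g • K}
  one_mem' K _ := ⟨1, by simp⟩
  mul_mem' := by
    intro f f' hf hf' K hK
    obtain ⟨a, ha⟩ := hf' K hK
    obtain ⟨b, hb⟩ := hf K hK
    refine ⟨f a * b, ?_⟩
    have hc : f * MulAut.conj a = MulAut.conj (f a) * f := by
      ext x; simp
    rw [mul_smul, ha, ← mul_smul, hc, mul_smul, hb, ← mul_smul, map_mul]
  inv_mem' := by
    intro f hf K hK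
    obtain ⟨a, ha⟩ := hf K hK
    refine ⟨f⁻¹ a⁻¹, ?_⟩
    have hc : f⁻¹ * MulAut.conj a⁻¹ = MulAut.conj (f⁻¹ a⁻¹) * f⁻¹ := by
      ext x; simp
    have hK' : K = MulAut.conj a⁻¹ • f • K := by
      rw [ha, ← mul_smul, ← map_mul]; simp
    calc f⁻¹ • K = f⁻¹ • MulAut.conj a⁻¹ • f • K := by rw [← hK']
      _ = MulAut.conj (f⁻¹ a⁻¹) • f⁻¹ • f • K := by rw [← mul_smul, hc, mul_smul]
      _ = MulAut.conj (f⁻¹ a⁻¹) • K := by rw [inv_smul_smul]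

/-- `G` virtually surjects onto `Q`: some finite-index subgroup of `G` maps onto `Q`. -/
def VirtuallySurjectsOnto (G Q : Type*) [Group G] [Group Q] : Prop :=
  ∃ H : Subgroup G, H.FiniteIndex ∧ ∃ φ : H →* Q, Function.Surjective φ

/-- Kazhdan's property (T) for a countable group `G`: every action of `G` by isometries on a real
Hilbert space (in the universe `t`) has a global fixed point. -/
def KazhdanPropertyT (G : Type u) [Group G] : Prop :=
  ∀ (H : Type t) [NormedAddCommGroup H] [InnerProductSpace ℝ H] [CompleteSpace H]
    (ρ : G →* (H ≃ᵢ H)), ∃ x : H, ∀ g : G, ρ g x = x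

/-- The free product `ℤ₂ * ℤ₂`. -/
abbrev Z2FreeProdZ2 : Type :=
  Monoid.Coprod (Multiplicative (ZMod 2)) (Multiplicative (ZMod 2))

/-! Finite index: the special automorphisms are those fixing every conjugacy class of involutions,
so it suffices that `W_Γ` has finitely many such classes. The tool is the cocycle `inversionParity`,
which marks the reflections inverting `w` and determines `w`. An involution of minimal length in its
class commutes with its descents; its inversions are then the conjugates of these descents inside
the parabolic subgroup they generate, so the finite set of descents determines it
(`IsDescentCentral.eq_of_isLeftDescent_iff`).

Surjection: evenness and non-adjacency give the retraction `r`. A special automorphism sends each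
generator to a conjugate, so it preserves the kernel of `r` and descends to the infinite dihedral
group. The descended automorphisms preserve the classes of both standard reflections, hence are
inner, and every inner one occurs. The center is trivial, so the image is the infinite dihedral
group itself.

Property (T): the reflections of the line about `0` and `1/2` have no common fixed point. Inducing
this action from the finite-index subgroup gives an action on a Euclidean space without fixed point.
-/

/-! ### The signed action on reflections: dihedral relations -/

section ReflectionPerm

variable {G : Type*} [Group G]

/-- The involution `(t, e) ↦ (s t s, e + [t = s])` of `G × ℤ/2`, for `s` with `s² = 1`. -/
noncomputable def reflectionPerm (s : G) (hs : s * s = 1) : Equiv.Perm (G × ZMod 2) :=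
  open Classical in
  Function.Involutive.toPerm (fun p => (s * p.1 * s, p.2 + if p.1 = s then 1 else 0)) (by
    rintro ⟨t, e⟩
    have h1 : s * (s * t * s) * s = t := by
      simp only [← mul_assoc, hs, one_mul]
      rw [mul_assoc, hs, mul_one]
    have h2 : s * t * s = s ↔ t = s := by
      rw [mul_eq_right, ← hs, mul_right_inj]
    ext1
    · exact h1
    · classical
      change e + (if t = s then 1 else 0) + (if s * t * s = s then 1 else 0) = e
      simp only [h2, add_assoc, CharTwo.add_self_eq_zero, add_zero])

open Classical in
theorem reflectionPerm_apply (s : G) (hs : s * s = 1) (t : G) (e : ZMod 2) :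
    reflectionPerm s hs (t, e) = (s * t * s, e + if t = s then 1 else 0) := rfl

-- The sum runs over the `2 * n` reflections met along the alternating word of `a` and `b`, with
-- multiplicity.
open Classical in
theorem reflectionPerm_mul_pow_apply {a b : G} (ha : a * a = 1) (hb : b * b = 1) (n : ℕ)
    (t : G) (e : ZMod 2) :
    ((reflectionPerm a ha * reflectionPerm b hb) ^ n) (t, e) =
      ((a * b) ^ n * t * ((a * b) ^ n)⁻¹,
        e + ∑ k ∈ Finset.range (2 * n), if t = b * (a * b) ^ k then 1 else 0) := by
  have hinv : (a * b)⁻¹ = b * a := by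
    rw [mul_inv_rev, inv_eq_of_mul_eq_one_left ha, inv_eq_of_mul_eq_one_left hb]
  have hcomm : ∀ k : ℕ, b * (a * b) ^ k = ((a * b) ^ k)⁻¹ * b := by
    intro k
    have h : SemiconjBy b (a * b) (a * b)⁻¹ := by
      rw [hinv]; simp [SemiconjBy, mul_assoc]
    rw [← inv_pow]
    exact h.pow_right k
  induction n with
  | zero => simp
  | succ n ih =>
    have e1 : ((a * b) ^ n * t * ((a * b) ^ n)⁻¹ = b) ↔ t = b * (a * b) ^ (2 * n) := by
      rw [two_mul, pow_add, ← mul_assoc, hcomm n, mul_inv_eq_iff_eq_mul, mul_assoc,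
        eq_inv_mul_iff_mul_eq]
    have e2 : (b * ((a * b) ^ n * t * ((a * b) ^ n)⁻¹) * b = a) ↔
        t = b * (a * b) ^ (2 * n + 1) := by
      have h1 : ∀ y : G, b * y * b = a ↔ y = b * a * b := by
        refine fun y => ⟨?_, ?_⟩
        · rintro rfl
          simp only [← mul_assoc, hb, one_mul]
          rw [mul_assoc, hb, mul_one]
        · rintro rfl
          simp only [← mul_assoc, hb, one_mul]
          rw [mul_assoc, hb, mul_one]
      rw [h1, show 2 * n + 1 = n + 1 + n by ring, pow_add, ← mul_assoc, hcomm (n + 1), pow_succ',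
        mul_inv_rev, hinv, mul_inv_eq_iff_eq_mul, ← eq_inv_mul_iff_mul_eq]
      simp only [mul_assoc]
    rw [pow_succ', Equiv.Perm.mul_apply, ih, Equiv.Perm.mul_apply, reflectionPerm_apply,
      reflectionPerm_apply, Prod.mk.injEq]
    refine ⟨?_, ?_⟩
    · rw [pow_succ', mul_inv_rev, hinv]; simp only [mul_assoc]
    · rw [show 2 * (n + 1) = 2 * n + 1 + 1 by ring, Finset.sum_range_succ, Finset.sum_range_succ]
      simp only [e1, e2, add_assoc]

theorem reflectionPerm_mul_pow_eq_one {a b : G} (ha : a * a = 1) (hb : b * b = 1) {n : ℕ}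
    (hn : (a * b) ^ n = 1) : (reflectionPerm a ha * reflectionPerm b hb) ^ n = 1 := by
  classical
  ext1 ⟨t, e⟩
  -- The terms for `k` and `n + k` agree since `(a * b) ^ n = 1`, so the sum cancels mod 2.
  rw [reflectionPerm_mul_pow_apply, hn, two_mul, Finset.sum_range_add]
  simp [pow_add, hn, CharTwo.add_self_eq_zero]

end ReflectionPerm

/-! ### Inversions, descents and conjugacy classes of involutions -/

namespace CoxeterSystem

open List

variable {B : Type*} {W : Type*} [Group W] {M : CoxeterMatrix B} (cs : CoxeterSystem M W)

/-- The action of a Coxeter group on `W × ℤ/2` in which `sᵢ` acts by `reflectionPerm`. -/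
noncomputable def reflectionAction : W →* Equiv.Perm (W × ZMod 2) :=
  cs.lift ⟨fun i => reflectionPerm (cs.simple i) (cs.simple_mul_simple_self i), fun i j =>
    reflectionPerm_mul_pow_eq_one _ _ (cs.simple_mul_simple_pow i j)⟩

open Classical in
theorem reflectionAction_simple_apply (i : B) (t : W) (e : ZMod 2) :
    cs.reflectionAction (cs.simple i) (t, e) =
      (cs.simple i * t * cs.simple i, e + if t = cs.simple i then 1 else 0) := by
  exact congrArg (fun σ : Equiv.Perm (W × ZMod 2) => σ (t, e)) (cs.lift_apply_simple _ i)

/-- The parity with which `t` occurs in the left inversion sequence of any word for `w`. -/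
noncomputable def inversionParity (w t : W) : ZMod 2 := (cs.reflectionAction w⁻¹ (t, 0)).2

theorem reflectionAction_apply (w t : W) (e : ZMod 2) :
    cs.reflectionAction w (t, e) = (w * t * w⁻¹, e + cs.inversionParity w⁻¹ t) := by
  induction w using cs.simple_induction_left generalizing t e with
  | one => simp [inversionParity]
  | mul_simple_left w i ih =>
    have h : cs.inversionParity (cs.simple i * w)⁻¹ t =
        (cs.reflectionAction (cs.simple i * w) (t, 0)).2 := by simp [inversionParity]
    rw [h, map_mul, Equiv.Perm.mul_apply, Equiv.Perm.mul_apply, ih, ih]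
    simp only [reflectionAction_simple_apply]
    simp [mul_assoc, add_assoc]

/-- The cocycle rule on which all later inversion arguments rest. -/
theorem inversionParity_mul (u w t : W) :
    cs.inversionParity (u * w) t =
      cs.inversionParity u t + cs.inversionParity w (u⁻¹ * t * u) := by
  conv_lhs => rw [inversionParity, mul_inv_rev, map_mul, Equiv.Perm.mul_apply,
    reflectionAction_apply, reflectionAction_apply]
  simp

@[simp]
theorem inversionParity_one (t : W) : cs.inversionParity 1 t = 0 := by
  simp [inversionParity]

open Classical in
theorem inversionParity_simple (i : B) (t : W) :
    cs.inversionParity (cs.simple i) t = if t = cs.simple i then 1 else 0 := by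
  rw [inversionParity, inv_simple, reflectionAction_simple_apply]
  simp

theorem mem_leftInvSeq_of_inversionParity_ne_zero (ω : List B) {t : W}
    (h : cs.inversionParity (cs.wordProd ω) t ≠ 0) : t ∈ cs.leftInvSeq ω := by
  induction ω generalizing t with
  | nil => simp at h
  | cons i ω ih =>
    rw [wordProd_cons, inversionParity_mul, inversionParity_simple] at h
    rw [leftInvSeq, mem_cons]
    by_cases ht : t = cs.simple i
    · exact Or.inl ht
    · rw [if_neg ht, zero_add] at h
      exact Or.inr (mem_map.2 ⟨_, ih h, by simp [mul_assoc]⟩)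

theorem length_mul_lt_of_inversionParity_ne_zero {w t : W} (h : cs.inversionParity w t ≠ 0) :
    cs.length (t * w) < cs.length w := by
  obtain ⟨ω, hω, rfl⟩ := cs.exists_isReduced w
  exact (cs.isLeftInversion_of_mem_leftInvSeq hω
    (cs.mem_leftInvSeq_of_inversionParity_ne_zero ω h)).2

theorem inversionParity_simple_ne_zero_iff (w : W) (i : B) :
    cs.inversionParity w (cs.simple i) ≠ 0 ↔ cs.IsLeftDescent w i := by
  refine ⟨fun h => cs.length_mul_lt_of_inversionParity_ne_zero h, fun h h0 => ?_⟩
  -- If the parity vanished at `w`, it would be 1 at `sᵢ w`, making `w` shorter than `sᵢ w`.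
  have h1 : cs.inversionParity (cs.simple i * w) (cs.simple i) ≠ 0 := by
    rw [inversionParity_mul, inversionParity_simple]
    simp [h0]
  have h2 := cs.length_mul_lt_of_inversionParity_ne_zero h1
  rw [simple_mul_simple_cancel_left] at h2
  exact lt_asymm h h2

theorem eq_one_of_inversionParity_eq_zero {w : W} (h : ∀ t, cs.inversionParity w t = 0) :
    w = 1 := by
  by_contra hw
  obtain ⟨i, hi⟩ := cs.exists_leftDescent_of_ne_one hw
  exact (cs.inversionParity_simple_ne_zero_iff w i).2 hi (h _)

theorem inversionParity_injective : Function.Injective cs.inversionParity := by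
  intro u w h
  have key : u⁻¹ * w = 1 := by
    refine cs.eq_one_of_inversionParity_eq_zero fun t => ?_
    have h1 : cs.inversionParity (u⁻¹ * u) t = 0 := by simp
    rwa [inversionParity_mul, h, ← inversionParity_mul] at h1
  exact (inv_mul_eq_one.1 key)

/-- The standard parabolic subgroup of the left descents of `w`. -/
def descentParabolic (w : W) : Subgroup W :=
  Subgroup.closure (cs.simple '' {i | cs.IsLeftDescent w i})

/-- By the cocycle rule, inversions of a product come from its factors up to conjugation inside the
parabolic subgroup. -/
theorem exists_conj_of_inversionParity_ne_zero {J : Set B} {a t : W}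
    (ha : a ∈ Subgroup.closure (cs.simple '' J)) (h : cs.inversionParity a t ≠ 0) :
    ∃ b ∈ Subgroup.closure (cs.simple '' J), ∃ i ∈ J, t = b * cs.simple i * b⁻¹ := by
  induction ha using Subgroup.closure_induction generalizing t with
  | mem x hx =>
    obtain ⟨i, hi, rfl⟩ := hx
    rw [inversionParity_simple] at h
    exact ⟨1, one_mem _, i, hi, by simpa using h⟩
  | one => simp at h
  | mul x y hx _ ihx ihy =>
    rw [inversionParity_mul] at h
    by_cases h' : cs.inversionParity x t = 0
    · rw [h', zero_add] at h
      obtain ⟨b, hb, i, hi, hbi⟩ := ihy h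
      refine ⟨x * b, mul_mem hx hb, i, hi, ?_⟩
      rw [mul_assoc, inv_mul_eq_iff_eq_mul] at hbi
      rw [eq_mul_inv_of_mul_eq hbi]
      group
    · exact ihx h'
  | inv x hx ih =>
    have h1 : cs.inversionParity (x⁻¹ * x) t = 0 := by simp
    rw [inversionParity_mul] at h1
    have h2 : cs.inversionParity x (x⁻¹⁻¹ * t * x⁻¹) ≠ 0 := by
      intro h3; rw [h3, add_zero] at h1; exact h h1
    obtain ⟨b, hb, i, hi, hbi⟩ := ih h2
    refine ⟨x⁻¹ * b, mul_mem (inv_mem hx) hb, i, hi, ?_⟩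
    rw [mul_assoc, inv_mul_eq_iff_eq_mul] at hbi
    rw [eq_mul_inv_of_mul_eq hbi]
    group

/-- `w` is an involution (or trivial) commuting with all its descents. -/
def IsDescentCentral (w : W) : Prop :=
  w * w = 1 ∧ ∀ i, cs.IsLeftDescent w i → Commute w (cs.simple i)

variable {cs}

/-- Let `P` be the descent parabolic. A shortest element `c * w` of the coset `P w` is trivial: any
right descent of it would lead to a shorter element of the same coset. -/
theorem IsDescentCentral.mem_descentParabolic {w : W} (hw : cs.IsDescentCentral w) :
    w ∈ cs.descentParabolic w := by
  obtain ⟨c, hc, hmin⟩ := (measure fun c => cs.length (c * w)).wf.has_min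
    (cs.descentParabolic w : Set W) ⟨1, one_mem _⟩
  have hmin' : ∀ d ∈ cs.descentParabolic w, cs.length (c * w) ≤ cs.length (d * w) :=
    fun d hd => not_lt.1 (hmin d hd)
  by_cases hu : c * w = 1
  · have h := inv_mem hc
    rwa [inv_eq_of_mul_eq_one_right hu] at h
  obtain ⟨i, hi⟩ := cs.exists_rightDescent_of_ne_one hu
  exfalso
  by_cases hiw : cs.IsLeftDescent w i
  · have h1 := hmin' (c * cs.simple i)
      (mul_mem hc (Subgroup.subset_closure ⟨i, hiw, rfl⟩))
    rw [mul_assoc, ← (hw.2 i hiw).eq, ← mul_assoc] at h1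
    exact absurd hi (not_lt.2 h1)
  -- Now `sᵢ` inverts `(c w)⁻¹` but not `w = (c w)⁻¹ c`, so its conjugate by `c w` is an inversion
  -- of `c`, hence lies in `P`; thus `c w sᵢ` lies in `P w`.
  · have h1 : cs.inversionParity ((c * w)⁻¹ * c) (cs.simple i) = 0 := by
      have : (c * w)⁻¹ * c = w := by
        rw [mul_inv_rev, inv_mul_cancel_right, inv_eq_of_mul_eq_one_left hw.1]
      rw [this]
      by_contra h
      exact hiw ((cs.inversionParity_simple_ne_zero_iff w i).1 h)
    have h2 : cs.inversionParity (c * w)⁻¹ (cs.simple i) ≠ 0 := by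
      rwa [inversionParity_simple_ne_zero_iff, isLeftDescent_inv_iff]
    rw [inversionParity_mul] at h1
    have h3 : cs.inversionParity c ((c * w)⁻¹⁻¹ * cs.simple i * (c * w)⁻¹) ≠ 0 := by
      intro h; rw [h, add_zero] at h1; exact h2 h1
    obtain ⟨b, hb, j, hj, hbj⟩ := cs.exists_conj_of_inversionParity_ne_zero hc h3
    rw [inv_inv, mul_inv_eq_iff_eq_mul, ← mul_assoc] at hbj
    have h4 := hmin' (b * cs.simple j * b⁻¹ * c)
      (mul_mem (mul_mem (mul_mem hb (Subgroup.subset_closure ⟨j, hj, rfl⟩)) (inv_mem hb)) hc)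
    rw [← hbj] at h4
    exact absurd hi (not_lt.2 h4)

/-- For a descent `s`, expand the parities of `w s = s w` by the cocycle rule on both sides; the two
indicator terms agree because `w` centralizes `s`. -/
theorem IsDescentCentral.inversionParity_conj {w b : W} (hw : cs.IsDescentCentral w)
    (hb : b ∈ cs.descentParabolic w) (t : W) :
    cs.inversionParity w (b * t * b⁻¹) = cs.inversionParity w t := by
  induction hb using Subgroup.closure_induction generalizing t with
  | mem x hx =>
    obtain ⟨i, hi, rfl⟩ := hx
    have hc := hw.2 i hi
    have h : cs.inversionParity (w * cs.simple i) t = cs.inversionParity (cs.simple i * w) t := by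
      rw [hc.eq]
    have h1 : w⁻¹ * t * w = cs.simple i ↔ t = cs.simple i := by
      rw [mul_assoc, inv_mul_eq_iff_eq_mul, hc.eq, mul_left_inj]
    rw [inversionParity_mul, inversionParity_mul, inversionParity_simple, inversionParity_simple,
      h1, add_comm, inv_simple] at h
    rw [inv_simple]
    exact (add_left_cancel h).symm
  | one => simp
  | mul x y _ _ ihx ihy =>
    rw [← ihy t, ← ihx (y * t * y⁻¹)]
    congr 1
    group
  | inv x _ ih =>
    rw [← ih]
    congr 1
    group

/-- The inversions are exactly the conjugates of the descents by the parabolic subgroup that these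
generate, and inversions determine the element. -/
theorem IsDescentCentral.eq_of_isLeftDescent_iff {w w' : W} (hw : cs.IsDescentCentral w)
    (hw' : cs.IsDescentCentral w') (h : ∀ i, cs.IsLeftDescent w i ↔ cs.IsLeftDescent w' i) :
    w = w' := by
  have key : ∀ {u u' : W}, cs.IsDescentCentral u → cs.IsDescentCentral u' →
      (∀ i, cs.IsLeftDescent u i ↔ cs.IsLeftDescent u' i) → ∀ t,
      cs.inversionParity u t ≠ 0 → cs.inversionParity u' t ≠ 0 := by
    intro u u' hu hu' h t ht
    obtain ⟨b, hb, i, hi, rfl⟩ :=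
      cs.exists_conj_of_inversionParity_ne_zero hu.mem_descentParabolic ht
    have hP : cs.descentParabolic u = cs.descentParabolic u' := by
      simp only [descentParabolic, h]
    rw [hu'.inversionParity_conj (by rw [← hP]; exact hb), inversionParity_simple_ne_zero_iff,
      ← h]
    exact hi
  refine cs.inversionParity_injective (funext fun t => ?_)
  have hZ : ∀ a b : ZMod 2, (a ≠ 0 ↔ b ≠ 0) → a = b := by decide
  exact hZ _ _ ⟨key hw hw' h t, key hw' hw (fun i => (h i).symm) t⟩

theorem isDescentCentral_of_length_le {w : W} (hw : w * w = 1)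
    (hmin : ∀ g, cs.length w ≤ cs.length (g * w * g⁻¹)) : cs.IsDescentCentral w := by
  refine ⟨hw, fun i hi => ?_⟩
  have hinv : w⁻¹ = w := inv_eq_of_mul_eq_one_left hw
  -- Otherwise `sᵢ w sᵢ` would be shorter than `w`. The cocycle rule for `w sᵢ` then forces `w⁻¹ sᵢ
  -- w = sᵢ`.
  have h1 : ¬ cs.IsLeftDescent (w * cs.simple i) i := by
    intro h
    have h2 := hmin (cs.simple i)
    rw [inv_simple, mul_assoc] at h2
    have h3 : cs.length (w * cs.simple i) < cs.length w := by
      rwa [← cs.length_inv, mul_inv_rev, inv_simple, hinv]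
    exact absurd (h.trans h3) (not_lt.2 h2)
  rw [← inversionParity_simple_ne_zero_iff, not_not, inversionParity_mul,
    inversionParity_simple] at h1
  rw [← inversionParity_simple_ne_zero_iff] at hi
  split_ifs at h1 with h
  · rw [mul_assoc, inv_mul_eq_iff_eq_mul] at h
    exact h.symm
  · rw [add_zero] at h1
    exact absurd h1 hi

/-- A Coxeter group of finite rank has finitely many conjugacy classes of involutions. -/
theorem exists_finite_conj_involutions [Finite B] (cs : CoxeterSystem M W) :
    ∃ S : Set W, S.Finite ∧ ∀ w : W, w * w = 1 → ∃ s ∈ S, IsConj w s := by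
  refine ⟨{w | cs.IsDescentCentral w}, ?_, fun w hw => ?_⟩
  · refine Set.Finite.of_injOn (f := fun w => {i | cs.IsLeftDescent w i}) (t := Set.univ)
      (fun _ _ => trivial) (fun w hw w' hw' h => ?_) Set.finite_univ
    exact hw.eq_of_isLeftDescent_iff hw' (Set.ext_iff.1 h)
  · obtain ⟨g, -, hg⟩ := (measure fun g => cs.length (g * w * g⁻¹)).wf.has_min
      Set.univ ⟨1, trivial⟩
    refine ⟨g * w * g⁻¹, isDescentCentral_of_length_le ?_ fun x => ?_, isConj_iff.2 ⟨g, rfl⟩⟩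
    · simp [mul_assoc, ← mul_assoc w w, hw]
    · have h : cs.length (g * w * g⁻¹) ≤ cs.length (x * g * w * (x * g)⁻¹) :=
        not_lt.1 (hg (x * g) trivial)
      simpa [mul_assoc] using h

end CoxeterSystem

/-! ### Special automorphisms and their index -/

open scoped Pointwise in
theorem smul_zpowers_mulAut {G : Type*} [Group G] (f : MulAut G) (x : G) :
    f • Subgroup.zpowers x = Subgroup.zpowers (f x) :=
  MonoidHom.map_zpowers (f : G →* G) x

/-- An automorphism is special if and only if it preserves the conjugacy classes of involutions. -/
theorem mem_specialAut_iff {G : Type*} [Group G] (f : MulAut G) :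
    f ∈ specialAut G ↔ ∀ x : G, x * x = 1 → IsConj x (f x) := by
  constructor
  · intro hf x hx
    rcases eq_or_ne x 1 with rfl | hx1
    · simp
    have hord : orderOf x = 2 := orderOf_eq_prime (by rw [sq, hx]) hx1
    obtain ⟨g, hg⟩ := hf (Subgroup.zpowers x) (by rw [Nat.card_zpowers, hord])
    rw [smul_zpowers_mulAut, smul_zpowers_mulAut] at hg
    have hmem : f x ∈ Subgroup.zpowers (MulAut.conj g x) := hg ▸ Subgroup.mem_zpowers _
    obtain ⟨k, hk⟩ := Subgroup.mem_zpowers_iff.1 hmem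
    rw [← map_zpow] at hk
    rcases Int.even_or_odd' k with ⟨m, rfl | rfl⟩
    · rw [zpow_mul, zpow_ofNat, sq, hx, one_zpow, map_one] at hk
      exact absurd ((map_eq_one_iff f f.injective).1 hk.symm) hx1
    · rw [zpow_add, zpow_mul, zpow_ofNat, sq, hx, one_zpow, one_mul, zpow_one] at hk
      exact isConj_iff.2 ⟨g, hk⟩
  · intro h K hK
    have : Finite K := Nat.finite_of_card_ne_zero (by omega)
    have : Nontrivial K := Finite.one_lt_card_iff_nontrivial.1 (by omega)
    obtain ⟨x, hx1⟩ := exists_ne (1 : K)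
    have hxx : (x : G) * x = 1 := by
      have := pow_card_eq_one' (x := x)
      rw [hK, sq] at this
      exact congrArg Subtype.val this
    have hx1' : (x : G) ≠ 1 := fun h => hx1 (Subtype.ext h)
    have hKx : Subgroup.zpowers (x : G) = K := by
      refine Subgroup.eq_of_le_of_card_ge (Subgroup.zpowers_le.2 x.2) ?_
      rw [Nat.card_zpowers, orderOf_eq_prime (by rw [sq, hxx]) hx1', hK]
    obtain ⟨g, hg⟩ := isConj_iff.1 (h x hxx)
    refine ⟨g, ?_⟩
    rw [← hKx, smul_zpowers_mulAut, smul_zpowers_mulAut, MulAut.conj_apply, hg]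

theorem conj_mem_specialAut {G : Type*} [Group G] (g : G) : MulAut.conj g ∈ specialAut G :=
  (mem_specialAut_iff _).2 fun _ _ => isConj_iff.2 ⟨g, rfl⟩

/-- Record where an automorphism sends each of finitely many class representatives, up to conjugacy;
equal records mean the same left coset. -/
theorem specialAut_finiteIndex {G : Type*} [Group G] {S : Set G} (hS : S.Finite)
    (h : ∀ x : G, x * x = 1 → ∃ s ∈ S, IsConj x s) : (specialAut G).FiniteIndex := by
  classical
  have hsq : ∀ (f : MulAut G) (x : G), x * x = 1 → f x * f x = 1 := fun f x hx => by
    rw [← map_mul, hx, map_one]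
  let T : Set G := {s ∈ S | s * s = 1}
  have : Finite T := hS.subset (Set.sep_subset _ _)
  choose! c hc hconj using h
  have hcsq : ∀ x, x * x = 1 → c x * c x = 1 := by
    intro x hx
    obtain ⟨g, hg⟩ := isConj_iff.1 (hconj x hx)
    rw [← hg, ← MulAut.conj_apply, hsq _ _ hx]
  let F : MulAut G → T → T := fun f t => ⟨c (f t), hc _ (hsq f t t.2.2), hcsq _ (hsq f t t.2.2)⟩
  have hF : ∀ f f', F f = F f' → f⁻¹ * f' ∈ specialAut G := by
    intro f f' hff
    rw [mem_specialAut_iff]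
    intro x hx
    have h1 : IsConj (f (c x)) (f' (c x)) := by
      have h2 := congrArg Subtype.val (congrFun hff ⟨c x, hc x hx, hcsq x hx⟩)
      have h3 := hconj _ (hsq f _ (hcsq x hx))
      have h4 := hconj _ (hsq f' _ (hcsq x hx))
      change c (f (c x)) = c (f' (c x)) at h2
      rw [h2] at h3
      exact h3.trans h4.symm
    have h5 : IsConj (f x) (f' x) :=
      (f.toMonoidHom.map_isConj (hconj x hx)).trans
        (h1.trans (f'.toMonoidHom.map_isConj (hconj x hx)).symm)
    simpa using (f⁻¹).toMonoidHom.map_isConj h5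
  have : Finite (MulAut G ⧸ specialAut G) := by
    refine Finite.of_injective (fun q => F q.out) fun p q hpq => ?_
    rw [← Quotient.out_eq' p, ← Quotient.out_eq' q]
    exact QuotientGroup.eq.2 (hF _ _ hpq)
  exact Subgroup.finiteIndex_of_finite_quotient

/-! ### The infinite dihedral group and its automorphisms -/

namespace DihedralGroup

/-- The homomorphism from the infinite dihedral group given by two involutions. -/
def liftInvolutions {G : Type*} [Group G] (a b : G) (ha : a * a = 1) (hb : b * b = 1) :
    DihedralGroup 0 →* G where
  toFun
    | r i => (a * b) ^ (show ℤ from i)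
    | sr i => a * (a * b) ^ (show ℤ from i)
  map_one' := zpow_zero _
  map_mul' := by
    have hinv : (a * b)⁻¹ = b * a := by
      rw [mul_inv_rev, inv_eq_of_mul_eq_one_left ha, inv_eq_of_mul_eq_one_left hb]
    have hcomm : ∀ k : ℤ, a * (a * b) ^ k = (a * b) ^ (-k) * a := by
      intro k
      have h : SemiconjBy a (a * b) (a * b)⁻¹ := by
        rw [hinv]; simp [SemiconjBy, ← mul_assoc, ha]; rw [mul_assoc, ha, mul_one]
      rw [← inv_zpow']
      exact h.zpow_right k
    rintro (i | i) (j | j)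
    · exact zpow_add (a * b) (show ℤ from i) (show ℤ from j)
    · change a * (a * b) ^ ((show ℤ from j) - (show ℤ from i)) =
        (a * b) ^ (show ℤ from i) * (a * (a * b) ^ (show ℤ from j))
      generalize (show ℤ from i) = i
      generalize (show ℤ from j) = j
      have h := hcomm (-i)
      rw [neg_neg] at h
      rw [← mul_assoc, ← h, mul_assoc, ← zpow_add, neg_add_eq_sub]
    · exact (congrArg (a * ·) (zpow_add (a * b) (show ℤ from i) (show ℤ from j))).trans
        (mul_assoc _ _ _).symm
    · change (a * b) ^ ((show ℤ from j) - (show ℤ from i)) =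
        a * (a * b) ^ (show ℤ from i) * (a * (a * b) ^ (show ℤ from j))
      generalize (show ℤ from i) = i
      generalize (show ℤ from j) = j
      rw [hcomm i, mul_assoc, ← mul_assoc a a, ha, one_mul, ← zpow_add, neg_add_eq_sub]

section
variable {G : Type*} [Group G] (a b : G) (ha : a * a = 1) (hb : b * b = 1)

@[simp]
theorem liftInvolutions_sr_zero : liftInvolutions a b ha hb (sr 0) = a := by
  change a * (a * b) ^ (0 : ℤ) = a
  simp

@[simp]
theorem liftInvolutions_sr_one : liftInvolutions a b ha hb (sr 1) = b := by
  change a * (a * b) ^ (1 : ℤ) = b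
  simp [← mul_assoc, ha]

end

theorem r_one_eq : (r 1 : DihedralGroup 0) = sr 0 * sr 1 := by simp

theorem hom_ext_sr {G : Type*} [Group G] {f g : DihedralGroup 0 →* G}
    (h0 : f (sr 0) = g (sr 0)) (h1 : f (sr 1) = g (sr 1)) : f = g := by
  have hr : ∀ i : ZMod 0, f (r i) = g (r i) := by
    intro i
    have h : (r i : DihedralGroup 0) = r 1 ^ (show ℤ from i) := by
      rw [r_one_zpow]; rfl
    rw [h, map_zpow, map_zpow, r_one_eq, map_mul, map_mul, h0, h1]
  ext (i | i)
  · exact hr i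
  · have h : (sr i : DihedralGroup 0) = sr 0 * r i := by simp
    rw [h, map_mul, map_mul, h0, hr]

theorem exists_conj_sr {i : ZMod 0} {x : DihedralGroup 0} (h : IsConj (sr i) x) :
    ∃ k : ZMod 0, x = sr (i + 2 * k) := by
  obtain ⟨g, rfl⟩ := isConj_iff.1 h
  rcases g with (j | j)
  · exact ⟨-j, by simp; ring⟩
  · exact ⟨j - i, by simp; ring⟩

/-- An automorphism of the infinite dihedral group that preserves the conjugacy classes of the two
standard generators is inner. -/
theorem mem_range_conj_of_isConj (α : MulAut (DihedralGroup 0)) (h0 : IsConj (sr 0) (α (sr 0)))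
    (h1 : IsConj (sr 1) (α (sr 1))) : α ∈ (MulAut.conj : DihedralGroup 0 →* _).range := by
  obtain ⟨a, ha⟩ := exists_conj_sr h0
  obtain ⟨b, hb⟩ := exists_conj_sr h1
  have hr1 : α (r 1) = r (1 + 2 * b - 2 * a) := by
    rw [r_one_eq, map_mul, ha, hb]; simp
  have hr : ∀ i : ZMod 0, α (r i) = r ((1 + 2 * b - 2 * a) * i) := by
    intro i
    have h : (r i : DihedralGroup 0) = r 1 ^ (show ℤ from i) := by
      rw [r_one_zpow]; rfl
    rw [h, map_zpow, hr1, r_zpow]; rfl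
  have hsr : ∀ i : ZMod 0, α (sr i) = sr (2 * a + (1 + 2 * b - 2 * a) * i) := by
    intro i
    have h : (sr i : DihedralGroup 0) = sr 0 * r i := by simp
    rw [h, map_mul, hr, ha]; simp
  -- `α` multiplies rotation indices by a constant; surjectivity makes it a unit of `ℤ`. The value
  -- `1` gives conjugation by a rotation, `-1` by a reflection.
  obtain ⟨i, hi⟩ : ∃ i : ZMod 0, (1 + 2 * b - 2 * a) * i = 1 := by
    obtain ⟨x, hx⟩ := α.surjective (r 1)
    rcases x with (i | i)
    · rw [hr] at hx
      exact ⟨i, by simpa using hx⟩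
    · rw [hsr] at hx
      simp at hx
  have hunit : IsUnit (1 + 2 * b - 2 * a) := IsUnit.of_mul_eq_one _ hi
  have key : ∀ g : DihedralGroup 0, MulAut.conj g (sr 0) = α (sr 0) →
      MulAut.conj g (sr 1) = α (sr 1) → α ∈ (MulAut.conj : DihedralGroup 0 →* _).range := by
    intro g h0 h1
    refine ⟨g, MulEquiv.ext fun x => ?_⟩
    exact DFunLike.congr_fun (hom_ext_sr (f := (MulAut.conj g).toMonoidHom)
      (g := α.toMonoidHom) h0 h1) x
  rcases Int.isUnit_iff.1 hunit with h | h
  · have hab : b = a :=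
      (show ∀ a b : ℤ, 1 + 2 * b - 2 * a = 1 → b = a by omega) a b h
    subst hab
    refine key (r (-b)) ?_ ?_
    · rw [ha]; simp; ring
    · rw [hb]; simp; ring
  · have hab : b = a - 1 :=
      (show ∀ a b : ℤ, 1 + 2 * b - 2 * a = -1 → b = a - 1 by omega) a b h
    subst hab
    refine key (sr a) ?_ ?_
    · rw [ha]; simp; ring
    · rw [hb]; simp; ring

/-- The center is trivial: a nontrivial rotation moves `sr 0`, and a reflection inverts `r 1`. -/
theorem conj_injective : Function.Injective (MulAut.conj : DihedralGroup 0 →* _) := by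
  rw [injective_iff_map_eq_one]
  intro g hg
  have h0 : MulAut.conj g (sr 0) = sr 0 := by rw [hg]; rfl
  have h1 : MulAut.conj g (r 1) = r 1 := by rw [hg]; rfl
  rcases g with (i | i)
  · simp at h0
    rw [h0]; rfl
  · simp at h1
end DihedralGroup

/-! ### Free products of two groups of order two -/

/-- The homomorphism from the cyclic group of order two given by an involution. -/
def zmodTwoLift {G : Type*} [Group G] (a : G) (ha : a * a = 1) :
    Multiplicative (ZMod 2) →* G :=
  AddMonoidHom.toMultiplicativeLeft
    (ZMod.lift 2 ⟨zmultiplesHom (Additive G) (Additive.ofMul a), by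
      apply Additive.toMul.injective
      simpa [sq] using ha⟩)

theorem zmodTwoLift_ofAdd_one {G : Type*} [Group G] (a : G) (ha : a * a = 1) :
    zmodTwoLift a ha (Multiplicative.ofAdd 1) = a := by
  have h := ZMod.lift_coe 2 (⟨zmultiplesHom (Additive G) (Additive.ofMul a), by
      apply Additive.toMul.injective
      simpa [sq] using ha⟩ : {f : ℤ →+ Additive G // f 2 = 0}) 1
  simp at h
  exact h

theorem multiplicative_zmodTwo_hom_ext {G : Type*} [Group G] {f g : Multiplicative (ZMod 2) →* G}
    (h : f (Multiplicative.ofAdd 1) = g (Multiplicative.ofAdd 1)) : f = g := by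
  refine MonoidHom.ext fun x => ?_
  have hx : ∀ y : ZMod 2, y = 0 ∨ y = 1 := by decide
  rcases hx x.toAdd with h' | h'
  · rw [show x = 1 from Multiplicative.toAdd.injective h', map_one, map_one]
  · rw [show x = Multiplicative.ofAdd 1 from Multiplicative.toAdd.injective h', h]

/-- `ℤ₂ * ℤ₂` is the infinite dihedral group. -/
noncomputable def coprodEquivDihedral : Z2FreeProdZ2 ≃* DihedralGroup 0 :=
  MonoidHom.toMulEquiv
    (Monoid.Coprod.lift (zmodTwoLift (DihedralGroup.sr 0) (by simp))
      (zmodTwoLift (DihedralGroup.sr 1) (by simp)))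
    (DihedralGroup.liftInvolutions (Monoid.Coprod.inl (Multiplicative.ofAdd 1))
      (Monoid.Coprod.inr (Multiplicative.ofAdd 1))
      (by rw [← map_mul, ← map_one Monoid.Coprod.inl]; rfl)
      (by rw [← map_mul, ← map_one Monoid.Coprod.inr]; rfl))
    (by
      apply Monoid.Coprod.hom_ext <;> apply multiplicative_zmodTwo_hom_ext <;>
        simp [zmodTwoLift_ofAdd_one])
    (by
      apply DihedralGroup.hom_ext_sr <;> simp [zmodTwoLift_ofAdd_one])

theorem coprodEquivDihedral_inl :
    coprodEquivDihedral (Monoid.Coprod.inl (Multiplicative.ofAdd 1)) = DihedralGroup.sr 0 := by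
  simp [coprodEquivDihedral, zmodTwoLift_ofAdd_one]

theorem coprodEquivDihedral_inr :
    coprodEquivDihedral (Monoid.Coprod.inr (Multiplicative.ofAdd 1)) = DihedralGroup.sr 1 := by
  simp [coprodEquivDihedral, zmodTwoLift_ofAdd_one]

theorem exists_mulEquiv_zmodTwo {A : Type*} [Group A] (a : A) (hcard : Nat.card A = 2)
    (ha : a ≠ 1) : ∃ e : A ≃* Multiplicative (ZMod 2), e a = Multiplicative.ofAdd 1 := by
  have e : A ≃* Multiplicative (ZMod 2) :=
    mulEquivOfPrimeCardEq (p := 2) hcard (by simp [Nat.card_eq_fintype_card])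
  refine ⟨e, ?_⟩
  have hx : ∀ y : ZMod 2, y = 0 ∨ y = 1 := by decide
  rcases hx (e a).toAdd with h | h
  · exact absurd ((map_eq_one_iff e e.injective).1 (Multiplicative.toAdd.injective h)) ha
  · exact Multiplicative.toAdd.injective h

/-- The free product of two groups of order two is the infinite dihedral group. -/
theorem exists_coprod_mulEquiv_dihedral {A B : Type*} [Group A] [Group B] (a : A) (b : B)
    (hA : Nat.card A = 2) (hB : Nat.card B = 2) (ha : a ≠ 1) (hb : b ≠ 1) :
    ∃ e : Monoid.Coprod A B ≃* DihedralGroup 0,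
      e (Monoid.Coprod.inl a) = DihedralGroup.sr 0 ∧
      e (Monoid.Coprod.inr b) = DihedralGroup.sr 1 := by
  obtain ⟨f, hf⟩ := exists_mulEquiv_zmodTwo a hA ha
  obtain ⟨g, hg⟩ := exists_mulEquiv_zmodTwo b hB hb
  refine ⟨(MulEquiv.coprodCongr f g).trans coprodEquivDihedral, ?_, ?_⟩
  · rw [← coprodEquivDihedral_inl, ← hf]; simp
  · rw [← coprodEquivDihedral_inr, ← hg]; simp

/-! ### Induced isometric actions and property (T) -/

section InducedAction

variable {G : Type*} [Group G] (H : Subgroup G)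

/-- The cocycle of `G` on `G ⧸ H` with values in `H` given by coset representatives. -/
noncomputable def cosetCocycle (g : G) (c : G ⧸ H) : H :=
  ⟨(g • c).out⁻¹ * (g * c.out), QuotientGroup.eq.1 (by
    rw [QuotientGroup.out_eq', ← smul_eq_mul, ← MulAction.Quotient.smul_mk,
      QuotientGroup.out_eq'])⟩

theorem cosetCocycle_one (c : G ⧸ H) : cosetCocycle H 1 c = 1 := by
  ext; simp [cosetCocycle]

theorem cosetCocycle_mul (g g' : G) (c : G ⧸ H) :
    cosetCocycle H (g * g') c = cosetCocycle H g (g' • c) * cosetCocycle H g' c := by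
  ext
  simp [cosetCocycle, mul_smul, mul_assoc]

variable {H} {X : Type*} (e : X ≃ G ⧸ H) (τ : H →* (ℝ ≃ᵢ ℝ))

/-- The action of `G` on the real functions on `G ⧸ H` that is induced by an action of `H` on the
real line. -/
noncomputable def inducedFun (g : G) (F : X → ℝ) (x : X) : ℝ :=
  τ (cosetCocycle H g (g⁻¹ • e x)) (F (e.symm (g⁻¹ • e x)))

theorem inducedFun_one (F : X → ℝ) : inducedFun e τ 1 F = F := by
  ext x
  simp [inducedFun, cosetCocycle_one]

theorem inducedFun_mul (g g' : G) (F : X → ℝ) :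
    inducedFun e τ (g * g') F = inducedFun e τ g (inducedFun e τ g' F) := by
  ext x
  simp only [inducedFun, cosetCocycle_mul, map_mul, mul_inv_rev, mul_smul, smul_inv_smul,
    Equiv.apply_symm_apply]
  rfl

variable [Fintype X]

/-- The induced action, as an isometry of a Euclidean space. -/
noncomputable def inducedIsometry (g : G) : EuclideanSpace ℝ X ≃ᵢ EuclideanSpace ℝ X where
  toFun F := WithLp.toLp 2 (inducedFun e τ g F.ofLp)
  invFun F := WithLp.toLp 2 (inducedFun e τ g⁻¹ F.ofLp)
  left_inv F := by
    simp only [← inducedFun_mul, inv_mul_cancel, inducedFun_one]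
  right_inv F := by
    simp only [← inducedFun_mul, mul_inv_cancel, inducedFun_one]
  isometry_toFun := by
    refine Isometry.of_dist_eq fun F F' => ?_
    rw [EuclideanSpace.dist_eq, EuclideanSpace.dist_eq]
    congr 1
    simp only [inducedFun, (τ _).dist_eq]
    exact Equiv.sum_comp ((e.trans (MulAction.toPerm g⁻¹)).trans e.symm)
      (fun x => dist (F.ofLp x) (F'.ofLp x) ^ 2)

/-- The homomorphism to the isometry group of a Euclidean space that is induced by an isometric
action of a finite-index subgroup on the real line. -/
noncomputable def inducedRep : G →* (EuclideanSpace ℝ X ≃ᵢ EuclideanSpace ℝ X) where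
  toFun := inducedIsometry e τ
  map_one' := by
    ext F x
    exact congrFun (inducedFun_one e τ F.ofLp) x
  map_mul' g g' := by
    ext F x
    exact congrFun (inducedFun_mul e τ g g' F.ofLp) x

/-- The stabilizer of the trivial coset is `H`, and it acts on the coordinate there through `τ`, up
to conjugation in `H`. -/
theorem exists_fixed_of_inducedRep_fixed {F : EuclideanSpace ℝ X}
    (hF : ∀ g, inducedRep e τ g F = F) : ∃ y : ℝ, ∀ h : H, τ h y = y := by
  let c : G ⧸ H := ((1 : G) : G ⧸ H)
  have hmem : c.out ∈ H := by
    have h := QuotientGroup.eq.1 (show ((1 : G) : G ⧸ H) = (c.out : G ⧸ H) by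
      rw [QuotientGroup.out_eq'])
    simpa using h
  refine ⟨F.ofLp (e.symm c), fun h => ?_⟩
  -- The chosen representative of the trivial coset need not be `1`; this conjugate has cocycle
  -- value exactly `h`.
  let g : H := ⟨c.out, hmem⟩ * h * ⟨c.out, hmem⟩⁻¹
  have hfix : ∀ k : H, (k : G) • c = c := fun k =>
    QuotientGroup.eq.2 (by simp)
  have h1 : F.ofLp (e.symm c) = inducedFun e τ (g : G) F.ofLp (e.symm c) := by
    conv_lhs => rw [← hF g]
    rfl
  have h2 : cosetCocycle H (g : G) c = h := by
    ext
    simp only [cosetCocycle, hfix g]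
    simp [g, mul_assoc]
  have h3 : (g : G)⁻¹ • c = c := hfix g⁻¹
  rw [inducedFun, Equiv.apply_symm_apply, h3, h2] at h1
  exact h1.symm

end InducedAction

/-- The action of the infinite dihedral group on the real line. -/
noncomputable def dihedralRealAction : DihedralGroup 0 →* (ℝ ≃ᵢ ℝ) :=
  DihedralGroup.liftInvolutions (IsometryEquiv.neg ℝ) (IsometryEquiv.subLeft (1 : ℝ))
    (by ext; simp) (by ext; simp)

theorem dihedralRealAction_not_fixed (y : ℝ) : ¬ ∀ d, dihedralRealAction d y = y := by
  intro h
  have h0 := h (DihedralGroup.sr 0)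
  have h1 := h (DihedralGroup.sr 1)
  rw [dihedralRealAction, DihedralGroup.liftInvolutions_sr_zero] at h0
  rw [dihedralRealAction, DihedralGroup.liftInvolutions_sr_one] at h1
  simp at h0 h1
  linarith

/-- A group that virtually surjects onto the infinite dihedral group does not have property (T). -/
theorem VirtuallySurjectsOnto.not_kazhdanPropertyT {G : Type u} [Group G]
    (h : VirtuallySurjectsOnto G (DihedralGroup 0)) : ¬ KazhdanPropertyT.{u, t} G := by
  obtain ⟨H, hH, φ, hφ⟩ := h
  intro hT
  have : Finite (G ⧸ H) := Subgroup.finite_quotient_of_finiteIndex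
  -- Reindexing the cosets puts the Euclidean space into the universe `t`.
  let e : ULift.{t} (Fin (Nat.card (G ⧸ H))) ≃ G ⧸ H :=
    Equiv.ulift.trans (Finite.equivFin (G ⧸ H)).symm
  obtain ⟨F, hF⟩ := hT _ (inducedRep e (dihedralRealAction.comp φ))
  obtain ⟨y, hy⟩ := exists_fixed_of_inducedRep_fixed e _ hF
  refine dihedralRealAction_not_fixed y fun d => ?_
  obtain ⟨k, rfl⟩ := hφ d
  exact hy k

/-! ### Descending automorphisms; countability -/

/-- If every automorphism in `S` descends along the surjection `r`, then `S` acts on its target. -/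
theorem exists_descended_action {G D : Type*} [Group G] [Group D] (S : Subgroup (MulAut G))
    (r : G →* D) (hr : Function.Surjective r)
    (h : ∀ f : S, ∃ φ : D →* D, ∀ x, φ (r x) = r ((f : MulAut G) x)) :
    ∃ Ψ : S →* MulAut D, ∀ (f : S) (x : G), Ψ f (r x) = r ((f : MulAut G) x) := by
  -- Surjectivity of `r` makes each `φ f` unique, so the choices respect composition and inverses.
  choose φ hφ using h
  have hinv : ∀ f : S, (φ f⁻¹).comp (φ f) = MonoidHom.id D := by
    intro f
    ext d
    obtain ⟨x, rfl⟩ := hr d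
    simp [hφ]
  let Ψ : S → MulAut D := fun f => MonoidHom.toMulEquiv (φ f) (φ f⁻¹) (hinv f) (by
    simpa using hinv f⁻¹)
  have hΨ : ∀ (f : S) (x : G), Ψ f (r x) = r ((f : MulAut G) x) := hφ
  refine ⟨⟨⟨Ψ, ?_⟩, ?_⟩, hΨ⟩
  · ext d
    obtain ⟨x, rfl⟩ := hr d
    simp [hΨ]
  · intro f f'
    ext d
    obtain ⟨x, rfl⟩ := hr d
    simp [hΨ]

theorem countable_mulAut_of_closure_eq_top {G ι : Type*} [Group G] [Finite ι] [Countable G]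
    (g : ι → G) (hg : Subgroup.closure (Set.range g) = ⊤) : Countable (MulAut G) := by
  refine Function.Injective.countable (f := fun (f : MulAut G) (i : ι) => f (g i))
    fun f f' h => ?_
  have heq : f.toMonoidHom = f'.toMonoidHom := by
    refine MonoidHom.eq_of_eqOn_dense hg ?_
    rintro _ ⟨i, rfl⟩
    exact congrFun h i
  exact MulEquiv.ext fun x => DFunLike.congr_fun heq x

/-! ### Coxeter groups of graphs and the retraction -/

namespace CoxeterGraph

variable {V : Type*} (Γ : CoxeterGraph V)

/-- The Coxeter system of `W_Γ`. -/
noncomputable abbrev system : CoxeterSystem Γ.toCoxeterMatrix Γ.W :=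
  Γ.toCoxeterMatrix.toCoxeterSystem

theorem system_simple (v : V) : Γ.system.simple v = Γ.gen v :=
  Γ.toCoxeterMatrix.toCoxeterSystem_simple ▸ rfl

theorem gen_mul_gen_self (v : V) : Γ.gen v * Γ.gen v = 1 := by
  rw [← system_simple, CoxeterSystem.simple_mul_simple_self]

theorem gen_ne_one (v : V) : Γ.gen v ≠ 1 := by
  rw [← system_simple]
  intro h
  have := Γ.system.length_simple v
  rw [h, CoxeterSystem.length_one] at this
  omega

theorem closure_range_gen : Subgroup.closure (Set.range Γ.gen) = ⊤ := by
  rw [← Γ.system.subgroup_closure_range_simple, show Γ.system.simple = Γ.gen from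
    funext Γ.system_simple]

theorem hom_ext_gen {G : Type*} [Group G] {f g : Γ.W →* G}
    (h : ∀ x, f (Γ.gen x) = g (Γ.gen x)) : f = g :=
  Γ.system.ext_simple fun i => by rw [system_simple]; exact h i

instance countable_W [Finite V] : Countable Γ.W :=
  Function.Surjective.countable Γ.system.wordProd_surjective

theorem card_genSubgroup (v : V) : Nat.card (Γ.genSubgroup v) = 2 := by
  rw [Nat.card_zpowers]
  exact orderOf_eq_prime (by rw [sq, gen_mul_gen_self]) (Γ.gen_ne_one v)

theorem genSelf_ne_one (v : V) : Γ.genSelf v ≠ 1 := fun h =>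
  Γ.gen_ne_one v (congrArg Subtype.val h)

theorem genSelf_mul_self (v : V) : Γ.genSelf v * Γ.genSelf v = 1 :=
  Subtype.ext (Γ.gen_mul_gen_self v)

theorem genSubgroup_hom_ext {G : Type*} [Group G] {v : V} {f g : Γ.genSubgroup v →* G}
    (h : f (Γ.genSelf v) = g (Γ.genSelf v)) : f = g := by
  ext ⟨x, hx⟩
  obtain ⟨k, rfl⟩ := Subgroup.mem_zpowers_iff.1 hx
  rw [show (⟨Γ.gen v ^ k, hx⟩ : Γ.genSubgroup v) = Γ.genSelf v ^ k from Subtype.ext (by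
    simp [genSelf]), map_zpow, map_zpow, h]

theorem toCoxeterMatrix_of_not_adj {v w : V} (h : ¬ Γ.graph.Adj v w) (hvw : v ≠ w) :
    Γ.toCoxeterMatrix v w = 0 := by
  simp [toCoxeterMatrix, h, hvw]

variable {Γ}

theorem IsEvenVertex.even_toCoxeterMatrix {v w : V} (hv : Γ.IsEvenVertex v) (hvw : v ≠ w) :
    Even (Γ.toCoxeterMatrix v w) := by
  by_cases h : Γ.graph.Adj v w
  · have h' := hv ⟨s(v, w), h⟩ (Sym2.mem_mk_left v w)
    simpa [toCoxeterMatrix, h] using h'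
  · rw [toCoxeterMatrix_of_not_adj Γ h hvw]
    exact Even.zero

theorem pow_even_eq_one {G : Type*} [Monoid G] {a : G} (ha : a * a = 1) {n : ℕ} (hn : Even n) :
    a ^ n = 1 := by
  obtain ⟨k, rfl⟩ := hn
  rw [← two_mul, pow_mul, sq, ha, one_pow]

/-- Two non-adjacent even vertices are sent to arbitrary involutions, all others to `1`. -/
theorem exists_hom_of_isEvenVertex {G : Type*} [Group G] {v w : V} (hvw : v ≠ w)
    (hnadj : ¬ Γ.graph.Adj v w) (hv : Γ.IsEvenVertex v) (hw : Γ.IsEvenVertex w) {a b : G}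
    (ha : a * a = 1) (hb : b * b = 1) :
    ∃ r : Γ.W →* G, r (Γ.gen v) = a ∧ r (Γ.gen w) = b ∧
      ∀ x, x ≠ v → x ≠ w → r (Γ.gen x) = 1 := by
  classical
  let f : V → G := fun x => if x = v then a else if x = w then b else 1
  have hfv : f v = a := if_pos rfl
  have hfw : f w = b := by simp [f, hvw.symm]
  have hfo : ∀ x, x ≠ v → x ≠ w → f x = 1 := fun x h h' => by simp [f, h, h']
  have hsq : ∀ x, f x * f x = 1 := by
    intro x
    simp only [f]
    split_ifs <;> simp [ha, hb]
  -- Only `f y` survives; if `y` is `v` or `w`, the exponent is even and `f y` squares to `1`.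
  have hpow : ∀ x y, f x = 1 → (f x * f y) ^ Γ.toCoxeterMatrix x y = 1 := by
    intro x y hx
    by_cases hxy : x = y
    · subst hxy; simp [hx]
    rw [hx, one_mul]
    by_cases hyv : y = v
    · rw [CoxeterMatrix.symmetric]
      exact pow_even_eq_one (hsq y) ((hyv ▸ hv).even_toCoxeterMatrix (Ne.symm hxy))
    by_cases hyw : y = w
    · rw [CoxeterMatrix.symmetric]
      exact pow_even_eq_one (hsq y) ((hyw ▸ hw).even_toCoxeterMatrix (Ne.symm hxy))
    rw [hfo y hyv hyw, one_pow]
  have hpow' : ∀ x y, f y = 1 → (f x * f y) ^ Γ.toCoxeterMatrix x y = 1 := by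
    intro x y hy
    have h := hpow y x hy
    rw [hy, one_mul, CoxeterMatrix.symmetric] at h
    rw [hy, mul_one, h]
  have hlift : Γ.toCoxeterMatrix.IsLiftable f := by
    intro x y
    by_cases hx : f x = 1
    · exact hpow x y hx
    by_cases hy : f y = 1
    · exact hpow' x y hy
    by_cases hxy : x = y
    · subst hxy; simp [hsq]
    have hmem : ∀ z, f z ≠ 1 → z = v ∨ z = w := fun z hz => by
      by_contra! h
      exact hz (hfo z h.1 h.2)
    rcases hmem x hx with rfl | rfl <;> rcases hmem y hy with rfl | rfl
    · exact absurd rfl hxy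
    -- Non-adjacency means exponent `0`, so nothing is required of `a * b`.
    · rw [toCoxeterMatrix_of_not_adj Γ hnadj hxy, pow_zero]
    · rw [toCoxeterMatrix_of_not_adj Γ (fun h => hnadj h.symm) hxy, pow_zero]
    · exact absurd rfl hxy
  have hr : ∀ x, Γ.system.lift ⟨f, hlift⟩ (Γ.gen x) = f x := fun x => by
    rw [← system_simple]; exact Γ.system.lift_apply_simple hlift x
  exact ⟨Γ.system.lift ⟨f, hlift⟩, (hr v).trans hfv, (hr w).trans hfw,
    fun x h h' => (hr x).trans (hfo x h h')⟩

theorem isConj_gen_of_mem_specialAut {f : MulAut Γ.W} (hf : f ∈ specialAut Γ.W) (x : V) :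
    IsConj (Γ.gen x) (f (Γ.gen x)) :=
  (mem_specialAut_iff f).1 hf _ (Γ.gen_mul_gen_self x)

end CoxeterGraph

/-! ### The image of the special automorphisms and the main theorem -/

/-- A group of automorphisms of the infinite dihedral group `D` that contains all inner ones and
preserves the conjugacy classes of the standard generators is isomorphic to `D`. -/
theorem nonempty_mulEquiv_of_conj_mem_of_isConj {D : Type*} [Group D]
    (e : D ≃* DihedralGroup 0) {S : Subgroup (MulAut D)}
    (hS : ∀ d, MulAut.conj d ∈ S)
    (h0 : ∀ α ∈ S, IsConj (e.symm (DihedralGroup.sr 0)) (α (e.symm (DihedralGroup.sr 0))))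
    (h1 : ∀ α ∈ S, IsConj (e.symm (DihedralGroup.sr 1)) (α (e.symm (DihedralGroup.sr 1)))) :
    Nonempty (S ≃* D) := by
  have hS' : S = (MulAut.conj : D →* MulAut D).range := by
    refine le_antisymm (fun α hα => ?_) ?_
    · have h := DihedralGroup.mem_range_conj_of_isConj ((e.symm.trans α).trans e)
        (by simpa using e.toMonoidHom.map_isConj (h0 α hα))
        (by simpa using e.toMonoidHom.map_isConj (h1 α hα))
      obtain ⟨g, hg⟩ := h
      refine ⟨e.symm g, MulEquiv.ext fun x => e.injective ?_⟩
      simpa using DFunLike.congr_fun hg (e x)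
    · rintro _ ⟨d, rfl⟩
      exact hS d
  have hinj : Function.Injective (MulAut.conj : D →* MulAut D) := by
    intro x y hxy
    refine e.injective (DihedralGroup.conj_injective (MulEquiv.ext fun z => ?_))
    simpa using congrArg e (DFunLike.congr_fun hxy (e.symm z))
  subst hS'
  exact ⟨(MonoidHom.ofInjective hinj).symm⟩

theorem theoremB {V : Type u} [Finite V] (Γ : CoxeterGraph V) (v w : V) (hvw : v ≠ w)
    (hnadj : ¬ Γ.graph.Adj v w) (hv : Γ.IsEvenVertex v) (hw : Γ.IsEvenVertex w) :
    -- the group of special automorphisms has finite index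
    (specialAut Γ.W).FiniteIndex ∧
    -- it surjects onto `ℤ₂ * ℤ₂`, through the retraction `r : W_Γ → ⟨v⟩ * ⟨w⟩`
    (∃ r : Γ.W →* Monoid.Coprod (Γ.genSubgroup v) (Γ.genSubgroup w),
      r (Γ.gen v) = Monoid.Coprod.inl (Γ.genSelf v) ∧
      r (Γ.gen w) = Monoid.Coprod.inr (Γ.genSelf w) ∧
      (∀ x : V, x ≠ v → x ≠ w → r (Γ.gen x) = 1) ∧
      Function.Surjective r ∧
      ∃ Ψ : specialAut Γ.W →* MulAut (Monoid.Coprod (Γ.genSubgroup v) (Γ.genSubgroup w)),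
        (∀ (f : specialAut Γ.W) (x : Γ.W), Ψ f (r x) = r ((f : MulAut Γ.W) x)) ∧
        Nonempty (Ψ.range ≃* Z2FreeProdZ2)) ∧
    (∃ ψ : specialAut Γ.W →* Z2FreeProdZ2, Function.Surjective ψ) ∧
    -- hence `Aut(W_Γ)` virtually surjects onto `ℤ₂ * ℤ₂`, the infinite dihedral group
    VirtuallySurjectsOnto (MulAut Γ.W) Z2FreeProdZ2 ∧
    VirtuallySurjectsOnto (MulAut Γ.W) (DihedralGroup 0) ∧
    -- and it is a countable group without property (T)
    Countable (MulAut Γ.W) ∧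
    ¬ KazhdanPropertyT.{u, t} (MulAut Γ.W) := by
  have hfin : (specialAut Γ.W).FiniteIndex := by
    obtain ⟨S, hS, h⟩ := Γ.system.exists_finite_conj_involutions
    exact specialAut_finiteIndex hS h
  obtain ⟨r, hrv, hrw, hro⟩ := CoxeterGraph.exists_hom_of_isEvenVertex hvw hnadj hv hw
    (a := (Monoid.Coprod.inl (Γ.genSelf v) :
      Monoid.Coprod (Γ.genSubgroup v) (Γ.genSubgroup w)))
    (b := Monoid.Coprod.inr (Γ.genSelf w))
    (by rw [← map_mul, CoxeterGraph.genSelf_mul_self, map_one])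
    (by rw [← map_mul, CoxeterGraph.genSelf_mul_self, map_one])
  have hcomp : ∀ f : Monoid.Coprod (Γ.genSubgroup v) (Γ.genSubgroup w) →* Γ.W,
      f (Monoid.Coprod.inl (Γ.genSelf v)) = Γ.gen v →
      f (Monoid.Coprod.inr (Γ.genSelf w)) = Γ.gen w → r.comp f = MonoidHom.id _ := by
    intro f h h'
    apply Monoid.Coprod.hom_ext <;> apply CoxeterGraph.genSubgroup_hom_ext
    · simp [h, hrv]
    · simp [h', hrw]
  -- The inclusions of `⟨v⟩` and `⟨w⟩` assemble to a section of `r`.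
  have hsurj : Function.Surjective r := fun d =>
    ⟨Monoid.Coprod.lift (Γ.genSubgroup v).subtype (Γ.genSubgroup w).subtype d,
      DFunLike.congr_fun (hcomp _ (by simp [CoxeterGraph.genSelf])
        (by simp [CoxeterGraph.genSelf])) d⟩
  obtain ⟨Ψ, hΨ⟩ := exists_descended_action (specialAut Γ.W) r hsurj (by
    intro f
    let rf : Γ.W →* Monoid.Coprod (Γ.genSubgroup v) (Γ.genSubgroup w) :=
      r.comp (f : MulAut Γ.W).toMonoidHom
    let φ := Monoid.Coprod.lift (rf.comp (Γ.genSubgroup v).subtype)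
      (rf.comp (Γ.genSubgroup w).subtype)
    have h : φ.comp r = rf := by
      refine Γ.hom_ext_gen fun x => ?_
      by_cases hxv : x = v
      · subst hxv; simp [φ, hrv, CoxeterGraph.genSelf]
      by_cases hxw : x = w
      · subst hxw; simp [φ, hrw, CoxeterGraph.genSelf]
      -- Being special is used here: `r (f x)` is conjugate to `r x = 1`, hence trivial.
      · have h1 := r.map_isConj (CoxeterGraph.isConj_gen_of_mem_specialAut f.2 x)
        rw [hro x hxv hxw, isConj_one_right] at h1
        rw [MonoidHom.comp_apply, hro x hxv hxw, map_one]
        exact h1.symm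
    exact ⟨φ, fun x => DFunLike.congr_fun h x⟩)
  obtain ⟨e, hev, hew⟩ := exists_coprod_mulEquiv_dihedral (Γ.genSelf v) (Γ.genSelf w)
    (Γ.card_genSubgroup v) (Γ.card_genSubgroup w) (Γ.genSelf_ne_one v) (Γ.genSelf_ne_one w)
  have hrange : Nonempty
      (Ψ.range ≃* Monoid.Coprod (Γ.genSubgroup v) (Γ.genSubgroup w)) := by
    refine nonempty_mulEquiv_of_conj_mem_of_isConj e (fun d => ?_) ?_ ?_
    · obtain ⟨g, rfl⟩ := hsurj d
      -- Inner automorphisms of `W_Γ` are special and descend to all inner automorphisms of the free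
      -- product.
      refine ⟨⟨MulAut.conj g, conj_mem_specialAut g⟩, MulEquiv.ext fun d => ?_⟩
      obtain ⟨x, rfl⟩ := hsurj d
      rw [hΨ]
      simp
    · rintro _ ⟨f, rfl⟩
      rw [← hev, e.symm_apply_apply, ← hrv, hΨ]
      exact r.map_isConj (CoxeterGraph.isConj_gen_of_mem_specialAut f.2 v)
    · rintro _ ⟨f, rfl⟩
      rw [← hew, e.symm_apply_apply, ← hrw, hΨ]
      exact r.map_isConj (CoxeterGraph.isConj_gen_of_mem_specialAut f.2 w)
  obtain ⟨i⟩ := hrange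
  have j : Ψ.range ≃* Z2FreeProdZ2 := (i.trans e).trans coprodEquivDihedral.symm
  have hψ : Function.Surjective (j.toMonoidHom.comp Ψ.rangeRestrict) :=
    j.surjective.comp Ψ.rangeRestrict_surjective
  have hD : VirtuallySurjectsOnto (MulAut Γ.W) (DihedralGroup 0) :=
    ⟨specialAut Γ.W, hfin, coprodEquivDihedral.toMonoidHom.comp
      (j.toMonoidHom.comp Ψ.rangeRestrict), coprodEquivDihedral.surjective.comp hψ⟩
  exact ⟨hfin, ⟨r, hrv, hrw, hro, hsurj, Ψ, hΨ, ⟨j⟩⟩, ⟨_, hψ⟩, ⟨specialAut Γ.W, hfin, _, hψ⟩, hD,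
    countable_mulAut_of_closure_eq_top Γ.gen Γ.closure_range_gen, hD.not_kazhdanPropertyT⟩
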